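/- Let $(\Omega,\mathcal A,\mu)$ be a finite measure space with $\mu(\Omega)>0$, let $\mathcal H$ be a real Hilbert space, and let $f\in L^2(\Omega;\mathcal H)$ (Bochner sense), with any representative fixed. Then $f$ has a Schmidt decomposition, that is, there are $r\in\mathbb N\cup\{\infty\}$ (with $0\in\mathbb N$), singular values $\sigma_1\ge\sigma_2\ge\cdots$ with $\sigma_i>0$ for all $1\le i\le r$ ($i<\infty$), and orthonormal systems $\{u_i\}_{i=1}^r$ in $\mathcal H$ and $\{v_i\}_{i=1}^r$ in $L^2(\Omega)$ such that $$f=\sum_{i=1}^r \sigma_i u_i v_i \quad\text{with convergence in } L^2(\Omega;\mathcal H).$$ For $k\ge 1$ and $\mathbf y=(y_1,\dots,y_k)\in\Omega^k$ let $G^{(k)}(\mathbf y)=\big[\langle f(y_i),f(y_j)\rangle\big]_{i,j=1}^k$ be the Gram matrix of $f(y_1),\dots,f(y_k)$, and let $\mu^{\otimes k}$ be the product measure on $\Omega^k$. Then $\det G^{(k)}$ is integrable with respect to $\mu^{\otimes k}$, and for every Schmidt decomposition of $f$ $$\int_{\Omega^k}\det G^{(k)}\,\mathrm d\mu^{\otimes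 k}=\sum_{\substack{j_1,\dots,j_k=1\\ j_1,\dots,j_k\text{ mutually distinct}}}^r\sigma_{j_1}^2\cdots\sigma_{j_k}^2 = k!\sum_{1\le j_1<\cdots<j_k\le r}\sigma_{j_1}^2\cdots\sigma_{j_k}^2,$$ where for $r=\infty$ the indices range over all positive integers and both series converge. -/

import Mathlib

open MeasureTheory

/-- The class of `y ↦ v y • u` in `L²(Ω; H)`, for `u ∈ H` and `v ∈ L²(Ω)`. -/
noncomputable def vecMulLp {Ω : Type*} [MeasurableSpace Ω] {μ : Measure Ω}
    {H : Type*} [NormedAddCommGroup H] [InnerProductSpace ℝ H]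
    (u : H) (v : Lp ℝ 2 μ) : Lp H 2 μ :=
  (ContinuousLinearMap.toSpanSingleton ℝ u).compLp v

/-- The defining property of `vecMulLp`. -/
theorem vecMulLp_coeFn {Ω : Type*} [MeasurableSpace Ω] {μ : Measure Ω}
    {H : Type*} [NormedAddCommGroup H] [InnerProductSpace ℝ H]
    (u : H) (v : Lp ℝ 2 μ) : vecMulLp u v =ᵐ[μ] fun y => v y • u :=
  ContinuousLinearMap.coeFn_compLp _ v

/-- The indices `1, …, r` of the singular values, written `0, …, r - 1`; all of `ℕ` if `r = ∞`. -/
abbrev SchmidtIndex (r : ℕ∞) : Type := {i : ℕ // (i : ℕ∞) < r}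

/-- A Schmidt decomposition `f = ∑ i, σ i • u i • v i` of `f ∈ L²(Ω; H)`: a rank
`r ∈ ℕ ∪ {∞}`, positive nonincreasing singular values `σ`, orthonormal systems `u` in `H` and
`v` in `L²(Ω)`, and convergence of the series in `L²(Ω; H)`. (The terms are pairwise orthogonal,
so convergence in the given order and unconditional convergence are the same.) -/
structure SchmidtDecomposition {Ω : Type*} [MeasurableSpace Ω] {μ : Measure Ω}
    {H : Type*} [NormedAddCommGroup H] [InnerProductSpace ℝ H] (f : Lp H 2 μ) where
  r : ℕ∞
  σ : SchmidtIndex r → ℝ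
  u : SchmidtIndex r → H
  v : SchmidtIndex r → Lp ℝ 2 μ
  σ_pos : ∀ i, 0 < σ i
  σ_antitone : Antitone σ
  orthonormal_u : Orthonormal ℝ u
  orthonormal_v : Orthonormal ℝ v
  hasSum : HasSum (fun i => σ i • vecMulLp (u i) (v i)) f

/-! Existence: the operator `C h = ⟪h, f ·⟫` from H to L²(Ω) is compact, so `C.adjoint ∘L C` has a
Hilbert basis of eigenvectors `b i`, whose images `C (b i)` are pairwise orthogonal. Normalising the
nonzero images gives the `v i`. Formula: replace f by its projection to the span of finitely many `u
i`. With φᵢ = ⟪uᵢ, f⟫ the Gram entries become finite sums ∑ φᵢ(yₐ) φᵢ(y_b), and the φᵢ are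
orthogonal in L²(Ω) with squared norms σᵢ². Leibniz and Fubini (`integral_det_sum_mul`) leave a sum
over tuples of indices, in which only injective tuples survive. Dominated convergence removes the
projection (`SchmidtDecomposition.hasSum_embedding`), and grouping tuples by their image gives the
factor k!. -/

open scoped InnerProductSpace

/-! ### Nonincreasing enumeration of a square-summable positive family. -/

section Ordering

/-- Each index is sent to the number of its predecessors in decreasing order of `a`, ties being
broken by an injection into ℕ. Square summability makes this number finite, and the ranks fill an
initial segment of ℕ. -/
theorem exists_schmidtIndex_equiv_antitone {ι : Type*} (a : ι → ℝ) (ha : ∀ i, 0 < a i)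
    (hs : Summable fun i => a i ^ 2) :
    ∃ (r : ℕ∞) (e : SchmidtIndex r ≃ ι), Antitone (a ∘ e) := by
  classical
  have hc : Countable ι := by
    have h := hs.countable_support
    have hu : Function.support (fun i => a i ^ 2) = Set.univ := by
      ext i; simpa using (ha i).ne'
    rw [hu] at h
    exact Set.countable_univ_iff.mp h
  obtain ⟨c, hcinj⟩ := exists_injective_nat ι
  let κ : ι → ℝ ×ₗ ℕ := fun i => toLex (-a i, c i)
  have hκ : Function.Injective κ := fun i j h => hcinj (congrArg (fun x => (ofLex x).2) h)
  have hfin : ∀ i, {j | κ j < κ i}.Finite := by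
    intro i
    have h1 : {j | a i ^ 2 ≤ a j ^ 2}.Finite := by
      have h2 := (hs.tendsto_cofinite_zero.eventually (gt_mem_nhds (pow_pos (ha i) 2)))
      simpa [Filter.eventually_cofinite] using h2
    refine h1.subset fun j hj => ?_
    have h3 : -a j ≤ -a i := by
      rcases Prod.Lex.toLex_lt_toLex.mp hj with h | h
      · exact h.le
      · exact h.1.le
    exact pow_le_pow_left₀ (ha i).le (by linarith) 2
  let rank : ι → ℕ := fun i => (hfin i).toFinset.card
  have hlt : ∀ {i j}, κ i < κ j → rank i < rank j := by
    intro i j hij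
    refine Finset.card_lt_card ⟨fun x hx => ?_, fun h => ?_⟩
    · simp only [Set.Finite.mem_toFinset, Set.mem_ofPred_eq] at hx ⊢
      exact hx.trans hij
    · have := @h i (by simpa using hij)
      simp at this
  have hle : ∀ {i j}, rank i ≤ rank j → κ i ≤ κ j := fun h =>
    not_lt.mp fun h' => (hlt h').not_ge h
  have hinj : Function.Injective rank := fun i j h => hκ (le_antisymm (hle h.le) (hle h.ge))
  have hlower : ∀ i n, n < rank i → ∃ j, rank j = n := by
    intro i n hn
    have himg : (hfin i).toFinset.image rank = Finset.range (rank i) := by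
      refine Finset.eq_of_subset_of_card_le ?_ ?_
      · intro x hx
        obtain ⟨j, hj, rfl⟩ := Finset.mem_image.mp hx
        exact Finset.mem_range.mpr (hlt (by simpa using hj))
      · rw [Finset.card_image_of_injective _ hinj, Finset.card_range]
    obtain ⟨j, -, hj⟩ := Finset.mem_image.mp (himg ▸ Finset.mem_range.mpr hn)
    exact ⟨j, hj⟩
  -- The supremum is 0 when `ι` is empty and ∞ when the ranks are unbounded.
  let r : ℕ∞ := ⨆ i, ((rank i + 1 : ℕ) : ℕ∞)
  have hr : ∀ i, (rank i : ℕ∞) < r := fun i =>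
    lt_of_lt_of_le (by exact_mod_cast Nat.lt_succ_self _)
      (le_iSup (fun i => ((rank i + 1 : ℕ) : ℕ∞)) i)
  let g : ι → SchmidtIndex r := fun i => ⟨rank i, hr i⟩
  have hg : Function.Bijective g := by
    refine ⟨fun i j h => hinj (congrArg Subtype.val h), fun ⟨n, hn⟩ => ?_⟩
    obtain ⟨i, hi⟩ := lt_iSup_iff.mp hn
    have hi' : n < rank i + 1 := by exact_mod_cast hi
    rcases (Nat.lt_succ_iff.mp hi').eq_or_lt with h | h
    · exact ⟨i, Subtype.ext h.symm⟩
    · obtain ⟨j, hj⟩ := hlower i n h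
      exact ⟨j, Subtype.ext hj⟩
  refine ⟨r, (Equiv.ofBijective g hg).symm, fun x y hxy => ?_⟩
  obtain ⟨i, rfl⟩ := hg.2 x
  obtain ⟨j, rfl⟩ := hg.2 y
  have hi : (Equiv.ofBijective g hg).symm (g i) = i := Equiv.ofBijective_symm_apply_apply g hg i
  have hj : (Equiv.ofBijective g hg).symm (g j) = j := Equiv.ofBijective_symm_apply_apply g hg j
  simp only [Function.comp, hi, hj]
  have hk : κ i ≤ κ j := hle hxy
  have : -a i ≤ -a j := by
    rcases Prod.Lex.toLex_le_toLex.mp hk with h | h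
    · exact h.le
    · exact h.1.le
  linarith

end Ordering

/-! ### The coefficient operator and its compactness. -/

section Coefficients

variable {Ω : Type*} [MeasurableSpace Ω] {μ : Measure Ω}
  {H : Type*} [NormedAddCommGroup H] [InnerProductSpace ℝ H]

/-- The operator `h ↦ ⟪h, F ·⟫` from `H` to `L²(Ω)`, as a continuous linear function of
`F ∈ L²(Ω; H)`. -/
noncomputable def coeffOp (μ : Measure Ω) (H : Type*) [NormedAddCommGroup H]
    [InnerProductSpace ℝ H] : Lp H 2 μ →L[ℝ] H →L[ℝ] Lp ℝ 2 μ :=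
  ((innerSL ℝ : H →L[ℝ] H →L[ℝ] ℝ).compLpL₂ 2 μ).flip

theorem coeffOp_coeFn (F : Lp H 2 μ) (h : H) : coeffOp μ H F h =ᵐ[μ] fun y => ⟪h, F y⟫_ℝ :=
  ContinuousLinearMap.coeFn_compLp (innerSL ℝ h) F

theorem coeffOp_injective [CompleteSpace H] : Function.Injective (coeffOp μ H) := by
  refine (injective_iff_map_eq_zero _).mpr fun F hF => ?_
  rw [Lp.eq_zero_iff_ae_eq_zero]
  refine ae_eq_zero_of_forall_dual_of_isSeparable ℝ (Lp.stronglyMeasurable F).isSeparable_range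
    (fun c => ?_) (Filter.Eventually.of_forall fun y => Set.mem_range_self y)
  obtain ⟨h, rfl⟩ := (InnerProductSpace.toDual ℝ H).surjective c
  have h0 : coeffOp μ H F h = 0 := by rw [hF]; rfl
  filter_upwards [coeffOp_coeFn F h, (Lp.eq_zero_iff_ae_eq_zero).mp h0] with y h1 h2
  rw [InnerProductSpace.toDual_apply_apply, ← h1, h2]

theorem coeffOp_vecMulLp (u : H) (v : Lp ℝ 2 μ) (h : H) :
    coeffOp μ H (vecMulLp u v) h = ⟪h, u⟫_ℝ • v := by
  refine Lp.ext ?_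
  filter_upwards [coeffOp_coeFn (vecMulLp u v) h, vecMulLp_coeFn u v,
    Lp.coeFn_smul ⟪h, u⟫_ℝ v] with y h1 h2 h3
  rw [h1, h2, h3, Pi.smul_apply, inner_smul_right, smul_eq_mul, mul_comm]

theorem inner_vecMulLp_left (u : H) (v : Lp ℝ 2 μ) (F : Lp H 2 μ) :
    ⟪vecMulLp u v, F⟫_ℝ = ⟪v, coeffOp μ H F u⟫_ℝ := by
  rw [L2.inner_def, L2.inner_def]
  refine integral_congr_ae ?_
  filter_upwards [coeffOp_coeFn F u, vecMulLp_coeFn u v] with y h1 h2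
  rw [h1, h2, inner_smul_left]
  simp [mul_comm]

theorem inner_vecMulLp_vecMulLp (u u' : H) (v v' : Lp ℝ 2 μ) :
    ⟪vecMulLp u v, vecMulLp u' v'⟫_ℝ = ⟪u, u'⟫_ℝ * ⟪v, v'⟫_ℝ := by
  rw [inner_vecMulLp_left, coeffOp_vecMulLp, inner_smul_right]

theorem orthonormal_vecMulLp {ι : Type*} {u : ι → H} {v : ι → Lp ℝ 2 μ}
    (hu : Orthonormal ℝ u) (hv : ∀ i, ‖v i‖ = 1) :
    Orthonormal ℝ fun i => vecMulLp (u i) (v i) := by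
  classical
  rw [orthonormal_iff_ite]
  intro i j
  rw [inner_vecMulLp_vecMulLp, orthonormal_iff_ite.mp hu i j]
  split_ifs with h
  · subst h; simp [hv]
  · simp

/-- Compact operators form a closed set and `coeffOp` is continuous and additive, so it suffices to
treat a constant times an indicator, whose operator factors through ℝ. -/
theorem isCompactOperator_coeffOp (F : Lp H 2 μ) : IsCompactOperator (coeffOp μ H F) := by
  refine Lp.induction (by norm_num) (fun F => IsCompactOperator (coeffOp μ H F))
    (fun c s hs hμs => ?_) (fun f g hf hg _ h1 h2 => ?_)
    (isClosed_setOfPred_isCompactOperator.preimage (coeffOp μ H).continuous) F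
  · have h : coeffOp μ H (vecMulLp c (indicatorConstLp 2 hs hμs.ne (1 : ℝ))) =
        (ContinuousLinearMap.toSpanSingleton ℝ (indicatorConstLp 2 hs hμs.ne (1 : ℝ))).comp
          (innerSL ℝ c) := by
      ext1 h
      simp [coeffOp_vecMulLp, real_inner_comm]
    rw [Lp.simpleFunc.coe_indicatorConst, indicatorConstLp_eq_toSpanSingleton_compLp]
    change IsCompactOperator (coeffOp μ H (vecMulLp c _))
    rw [h]
    have hc : IsCompactOperator (innerSL ℝ c : H →L[ℝ] ℝ) :=
      isCompactOperator_of_locallyCompactSpace_dom (innerSL ℝ c : H →L[ℝ] ℝ)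
    exact hc.clm_comp
      (ContinuousLinearMap.toSpanSingleton ℝ (indicatorConstLp 2 hs hμs.ne (1 : ℝ)))
  · rw [map_add]
    exact h1.add h2

end Coefficients

/-! ### Spectral theorem and existence of a Schmidt decomposition. -/

section Existence

universe w

/-- The eigenspaces, kernel included, are mutually orthogonal with dense sum, so Hilbert bases of
them combine to one of `H`. -/
theorem exists_hilbertBasis_eigenvectors {H : Type w} [NormedAddCommGroup H]
    [InnerProductSpace ℝ H] [CompleteSpace H] {T : H →L[ℝ] H}
    (hT : IsCompactOperator T) (hT' : T.IsSymmetric) :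
    ∃ (ι : Type w) (b : HilbertBasis ι ℝ H), ∀ i, ∃ c : ℝ, T (b i) = c • b i := by
  let E : ℝ → Submodule ℝ H := fun c => Module.End.eigenspace (T : Module.End ℝ H) c
  have hclosed : ∀ c, IsClosed (E c : Set H) := by
    intro c
    have : (E c : Set H) = {x | T x = c • x} := by
      ext x; simp [E]
    rw [this]
    exact isClosed_eq T.continuous (continuous_const_smul c)
  have hcomp : ∀ c, CompleteSpace (E c) := fun c => (hclosed c).completeSpace_coe
  choose w b hb using fun c => exists_hilbertBasis ℝ (E c)
  have hE : OrthogonalFamily ℝ (fun c => E c) fun c => (E c).subtypeₗᵢ :=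
    hT'.orthogonalFamily_eigenspaces
  have hon := hE.orthonormal_sigma_orthonormal (v_family := fun c => b c)
    (fun c => (b c).orthonormal)
  have hspan : (Submodule.span ℝ (Set.range fun a : Σ c, w c =>
      (E a.1).subtypeₗᵢ (b a.1 a.2)))ᗮ = ⊥ := by
    rw [eq_bot_iff, ← ContinuousLinearMap.orthogonalComplement_iSup_eigenspaces_eq_bot hT hT']
    intro x hx
    rw [← Submodule.iInf_orthogonal, Submodule.mem_iInf]
    intro c y hy
    rw [Submodule.mem_orthogonal] at hx
    have h0 := ((b c).hasSum_repr ⟨y, hy⟩).mapL (E c).subtypeL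
    have h1 := h0.mapL (innerSL ℝ x)
    rw [real_inner_comm]
    refine h1.unique ?_
    convert hasSum_zero using 2 with i
    have := hx _ (Submodule.subset_span ⟨⟨c, i⟩, rfl⟩)
    simp only [Submodule.coe_subtypeₗᵢ, Submodule.coe_subtype] at this
    rw [real_inner_comm] at this
    simp [this]
  refine ⟨Σ c, w c, HilbertBasis.mkOfOrthogonalEqBot hon hspan, fun ⟨c, i⟩ => ⟨c, ?_⟩⟩
  rw [HilbertBasis.coe_mkOfOrthogonalEqBot]
  exact Module.End.mem_eigenspace_iff.mp (b c i).2

variable {Ω : Type*} [MeasurableSpace Ω] {μ : Measure Ω}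
  {H : Type w} [NormedAddCommGroup H] [InnerProductSpace ℝ H] [CompleteSpace H]

theorem exists_hilbertBasis_orthogonal_coeffOp (F : Lp H 2 μ) :
    ∃ (ι : Type w) (b : HilbertBasis ι ℝ H),
      ∀ i j, i ≠ j → ⟪coeffOp μ H F (b i), coeffOp μ H F (b j)⟫_ℝ = 0 := by
  let C := coeffOp μ H F
  have hsymm : (C.adjoint ∘L C).IsSymmetric := by
    intro x y
    simp [ContinuousLinearMap.adjoint_inner_left, ContinuousLinearMap.adjoint_inner_right]
  obtain ⟨ι, b, hb⟩ := exists_hilbertBasis_eigenvectors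
    ((isCompactOperator_coeffOp F).clm_comp C.adjoint) hsymm
  refine ⟨ι, b, fun i j hij => ?_⟩
  obtain ⟨c, hc⟩ := hb j
  rw [← ContinuousLinearMap.adjoint_inner_right]
  change ⟪b i, (C.adjoint ∘L C) (b j)⟫_ℝ = 0
  rw [hc, inner_smul_right, b.orthonormal.inner_eq_zero hij, mul_zero]

theorem nonempty_schmidtDecomposition (F : Lp H 2 μ) : Nonempty (SchmidtDecomposition F) := by
  classical
  obtain ⟨ι, b, hb⟩ := exists_hilbertBasis_orthogonal_coeffOp F
  set C := coeffOp μ H F with hC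
  let ι' := {i : ι // C (b i) ≠ 0}
  let σ : ι' → ℝ := fun i => ‖C (b i)‖
  have hσ : ∀ i, 0 < σ i := fun i => norm_pos_iff.mpr i.2
  let u : ι' → H := fun i => b i
  let v : ι' → Lp ℝ 2 μ := fun i => (σ i)⁻¹ • C (b i)
  have hσv : ∀ i, σ i • v i = C (b i) := fun i => smul_inv_smul₀ (hσ i).ne' _
  have hu : Orthonormal ℝ u := b.orthonormal.comp _ Subtype.val_injective
  have hv1 : ∀ i, ‖v i‖ = 1 := by
    intro i
    rw [norm_smul, norm_inv, Real.norm_of_nonneg (hσ i).le]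
    exact inv_mul_cancel₀ (hσ i).ne'
  have hv : Orthonormal ℝ v := by
    refine ⟨hv1, fun i j hij => ?_⟩
    simp only [v, inner_smul_left, inner_smul_right]
    rw [hb _ _ fun h => hij (Subtype.ext h)]
    simp
  have hw := orthonormal_vecMulLp hu hv1
  have hwF : ∀ i, ⟪vecMulLp (u i) (v i), F⟫_ℝ = σ i := by
    intro i
    rw [inner_vecMulLp_left]
    change ⟪v i, C (b i)⟫_ℝ = σ i
    rw [← hσv, inner_smul_right, real_inner_self_eq_norm_sq, hv1]
    simp
  -- Bessel's inequality: the `σ i` are the coefficients of `F` in an orthonormal system.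
  have hsq : Summable fun i => σ i ^ 2 := by
    simpa [hwF] using hw.inner_products_summable (x := F)
  have hsum : Summable fun i => σ i • vecMulLp (u i) (v i) := by
    have := (hw.orthogonalFamily.summable_iff_norm_sq_summable σ).mpr (by simpa using hsq)
    simpa using this
  have hF : HasSum (fun i => σ i • vecMulLp (u i) (v i)) F := by
    obtain ⟨G, hG⟩ := hsum
    suffices h : G = F from h ▸ hG
    -- Both operators send `h` to ∑ ⟪b i, h⟫ • C (b i); the indices left out of `ι'` contribute
    -- zero.
    refine coeffOp_injective (ContinuousLinearMap.ext fun h => ?_)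
    have h1 : HasSum (fun i : ι' => ⟪b i, h⟫_ℝ • C (b i)) (coeffOp μ H G h) := by
      have := hG.mapL ((coeffOp μ H).flip h)
      simp only [map_smul, ContinuousLinearMap.flip_apply, coeffOp_vecMulLp] at this
      convert this using 2 with i
      rw [← hσv, smul_comm, real_inner_comm]
    have h2 : HasSum (fun i : ι => ⟪b i, h⟫_ℝ • C (b i)) (C h) := by
      simpa [b.repr_apply_apply] using (b.hasSum_repr h).mapL C
    refine h1.unique ((Subtype.val_injective.hasSum_iff (f := fun i : ι => ⟪b i, h⟫_ℝ • C (b i))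
      fun i hi => ?_).mpr h2)
    have : C (b i) = 0 := by
      by_contra h0
      exact hi ⟨⟨i, h0⟩, rfl⟩
    rw [this, smul_zero]
  obtain ⟨r, e, he⟩ := exists_schmidtIndex_equiv_antitone σ hσ hsq
  exact ⟨⟨r, σ ∘ e, u ∘ e, v ∘ e, fun i => hσ _, he, hu.comp _ e.injective, hv.comp _ e.injective,
    e.hasSum_iff.mpr hF⟩⟩

end Existence

/-! ### Bound, integrability and Leibniz expansion of Gram determinants. -/

section GramDeterminant

variable {Ω : Type*} [MeasurableSpace Ω] {μ : Measure Ω} [IsFiniteMeasure μ]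
  {H : Type*} [NormedAddCommGroup H] [InnerProductSpace ℝ H]

/-- Cauchy–Schwarz in each Leibniz term, where every norm occurs twice. This crude bound suffices as
an integrable majorant. -/
theorem abs_det_gram_le {k : ℕ} (x : Fin k → H) :
    |(Matrix.gram ℝ x).det| ≤ k.factorial * ∏ a, ‖x a‖ ^ 2 := by
  have hterm : ∀ τ : Equiv.Perm (Fin k),
      |((Equiv.Perm.sign τ : ℤ) : ℝ) * ∏ a, Matrix.gram ℝ x (τ a) a| ≤ ∏ a, ‖x a‖ ^ 2 := by
    intro τ
    have h1 : |((Equiv.Perm.sign τ : ℤ) : ℝ)| = 1 := by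
      rcases Int.units_eq_one_or (Equiv.Perm.sign τ) with h | h <;> simp [h]
    rw [abs_mul, h1, one_mul, Finset.abs_prod]
    calc ∏ a, |Matrix.gram ℝ x (τ a) a| ≤ ∏ a, ‖x (τ a)‖ * ‖x a‖ :=
          Finset.prod_le_prod (fun _ _ => abs_nonneg _) fun a _ => abs_real_inner_le_norm _ _
      _ = ∏ a, ‖x a‖ ^ 2 := by
          rw [Finset.prod_mul_distrib, Equiv.prod_comp τ fun a => ‖x a‖,
            ← Finset.prod_mul_distrib]
          simp only [sq]
  rw [Matrix.det_apply']
  refine (Finset.abs_sum_le_sum_abs _ _).trans ?_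
  refine (Finset.sum_le_sum fun τ _ => hterm τ).trans ?_
  simp [Fintype.card_perm]

theorem integrable_prod_norm_sq {E : Type*} [NormedAddCommGroup E] {f : Ω → E} (hf : MemLp f 2 μ) (k : ℕ) :
    Integrable (fun y : Fin k → Ω => ∏ a, ‖f (y a)‖ ^ 2) (Measure.pi fun _ => μ) :=
  Integrable.fintype_prod (f := fun _ x => ‖f x‖ ^ 2) fun _ =>
    (memLp_two_iff_integrable_sq_norm hf.1).mp hf

theorem aestronglyMeasurable_det_gram {f : Ω → H} (hf : AEStronglyMeasurable f μ) (k : ℕ) :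
    AEStronglyMeasurable (fun y : Fin k → Ω => (Matrix.gram ℝ fun a => f (y a)).det)
      (Measure.pi fun _ => μ) := by
  have h : ∀ a : Fin k, AEStronglyMeasurable (fun y : Fin k → Ω => f (y a))
      (Measure.pi fun _ => μ) := fun a =>
    hf.comp_quasiMeasurePreserving (Measure.quasiMeasurePreserving_eval (fun _ => μ) a)
  simp only [Matrix.det_apply', Matrix.gram_apply]
  refine Finset.aestronglyMeasurable_fun_sum _ fun τ _ => ?_
  refine AEStronglyMeasurable.const_mul ?_ _
  exact Finset.aestronglyMeasurable_fun_prod _ fun a _ => (h _).inner (h a)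

theorem integrable_det_gram {f : Ω → H} (hf : MemLp f 2 μ) (k : ℕ) :
    Integrable (fun y : Fin k → Ω => (Matrix.gram ℝ fun a => f (y a)).det)
      (Measure.pi fun _ => μ) :=
  ((integrable_prod_norm_sq hf k).const_mul (k.factorial : ℝ)).mono'
    (aestronglyMeasurable_det_gram hf.1 k)
    (Filter.Eventually.of_forall fun y => abs_det_gram_le fun a => f (y a))

/-- Leibniz expansion and integration of the determinant of a matrix of finite sums of products
of pairwise orthogonal functions. -/
theorem integral_det_sum_mul {I : Type*} [DecidableEq I] (φ : I → Ω → ℝ) (c : I → ℝ)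
    (hφ : ∀ i, MemLp (φ i) 2 μ)
    (hφc : ∀ i j, ∫ x, φ i x * φ j x ∂μ = if i = j then c i else 0) (k : ℕ) (s : Finset I) :
    ∫ y : Fin k → Ω, (Matrix.of fun a b => ∑ i ∈ s, φ i (y a) * φ i (y b)).det
        ∂(Measure.pi fun _ => μ) =
      ∑ j ∈ Fintype.piFinset fun _ : Fin k => s,
        if Function.Injective j then ∏ a, c (j a) else 0 := by
  have hint : ∀ i j, Integrable (fun x => φ i x * φ j x) μ := fun i j =>
    (hφ i).integrable_mul (hφ j)
  have hexp : ∀ y : Fin k → Ω,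
      (Matrix.of fun a b => ∑ i ∈ s, φ i (y a) * φ i (y b)).det =
        ∑ τ : Equiv.Perm (Fin k), ∑ j ∈ Fintype.piFinset fun _ : Fin k => s,
          ((Equiv.Perm.sign τ : ℤ) : ℝ) * ∏ a, φ (j (τ.symm a)) (y a) * φ (j a) (y a) := by
    intro y
    rw [Matrix.det_apply']
    refine Finset.sum_congr rfl fun τ _ => ?_
    simp only [Matrix.of_apply]
    rw [Finset.prod_univ_sum, Finset.mul_sum]
    refine Finset.sum_congr rfl fun j _ => ?_
    congr 1
    rw [Finset.prod_mul_distrib, Finset.prod_mul_distrib,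
      ← Equiv.prod_comp τ fun a => φ (j (τ.symm a)) (y a)]
    simp
  have hint' : ∀ (τ : Equiv.Perm (Fin k)) (j : Fin k → I), Integrable
      (fun y : Fin k → Ω =>
        ((Equiv.Perm.sign τ : ℤ) : ℝ) * ∏ a, φ (j (τ.symm a)) (y a) * φ (j a) (y a))
      (Measure.pi fun _ => μ) := fun τ j =>
    (Integrable.fintype_prod (f := fun a x => φ (j (τ.symm a)) x * φ (j a) x)
      fun a => hint _ _).const_mul _
  simp only [hexp]
  rw [integral_finsetSum _ fun τ _ => integrable_finsetSum _ fun j _ => hint' τ j]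
  simp only [integral_finsetSum _ fun j _ => hint' _ j]
  rw [Finset.sum_comm]
  refine Finset.sum_congr rfl fun j _ => ?_
  -- For fixed `j`, the sum over permutations is itself a Leibniz expansion, after replacing `τ` by
  -- its inverse.
  have hdet : ∑ τ : Equiv.Perm (Fin k), ∫ y : Fin k → Ω,
      ((Equiv.Perm.sign τ : ℤ) : ℝ) * ∏ a, φ (j (τ.symm a)) (y a) * φ (j a) (y a)
        ∂(Measure.pi fun _ => μ) =
      (Matrix.of fun a b => if j a = j b then c (j a) else 0 : Matrix (Fin k) (Fin k) ℝ).det := by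
    rw [Matrix.det_apply', ← Equiv.sum_comp (Equiv.inv (Equiv.Perm (Fin k)))]
    refine Finset.sum_congr rfl fun τ _ => ?_
    rw [integral_const_mul,
      integral_fintype_prod_eq_prod fun a x => φ (j ((Equiv.inv _ τ).symm a)) x * φ (j a) x]
    simp only [hφc]
    simp [Equiv.Perm.inv_def]
  rw [hdet]
  -- The matrix is diagonal for injective `j`; otherwise two rows coincide.
  split_ifs with hj
  · rw [← Matrix.det_diagonal]
    congr 1
    ext a b
    simp [Matrix.diagonal_apply, hj.eq_iff]
  · obtain ⟨a, b, hab, hne⟩ := Function.not_injective_iff.mp hj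
    refine Matrix.det_zero_of_row_eq hne ?_
    ext x
    simp [hab]

end GramDeterminant

/-! ### Orthonormal expansions and their partial sums. -/

section Limit

variable {H : Type*} [NormedAddCommGroup H] [InnerProductSpace ℝ H] {I : Type*} {u : I → H}

theorem inner_sum_inner_smul (hu : Orthonormal ℝ u) (s : Finset I) (x y : H) :
    ⟪∑ i ∈ s, ⟪u i, x⟫_ℝ • u i, ∑ i ∈ s, ⟪u i, y⟫_ℝ • u i⟫_ℝ =
      ∑ i ∈ s, ⟪u i, x⟫_ℝ * ⟪u i, y⟫_ℝ := by
  rw [hu.inner_sum]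
  simp

theorem norm_sum_inner_smul_le (hu : Orthonormal ℝ u) (s : Finset I) (x : H) :
    ‖∑ i ∈ s, ⟪u i, x⟫_ℝ • u i‖ ≤ ‖x‖ := by
  refine le_of_pow_le_pow_left₀ two_ne_zero (norm_nonneg _) ?_
  rw [← real_inner_self_eq_norm_sq, inner_sum_inner_smul hu]
  simpa [sq] using hu.sum_inner_products_le x (s := s)

theorem hasSum_inner_smul_of_mem_closure_span [CompleteSpace H] (hu : Orthonormal ℝ u) {x : H}
    (hx : x ∈ (Submodule.span ℝ (Set.range u)).topologicalClosure) :
    HasSum (fun i => ⟪u i, x⟫_ℝ • u i) x := by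
  set K := (Submodule.span ℝ (Set.range u)).topologicalClosure with hK
  have hKc : CompleteSpace K :=
    (Submodule.isClosed_topologicalClosure _).completeSpace_coe
  have hmem : ∀ i, u i ∈ K := fun i =>
    Submodule.le_topologicalClosure _ (Submodule.subset_span ⟨i, rfl⟩)
  have hbot : (Submodule.span ℝ (Set.range fun i => (⟨u i, hmem i⟩ : K)))ᗮ = ⊥ := by
    refine (Submodule.eq_bot_iff _).mpr fun z hz => ?_
    have h1 : (z : H) ∈ (Submodule.span ℝ (Set.range u))ᗮ := by
      rw [Submodule.mem_orthogonal]
      intro w hw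
      induction hw using Submodule.span_induction with
      | mem w hw =>
        obtain ⟨i, rfl⟩ := hw
        exact (Submodule.mem_orthogonal _ _).mp hz _ (Submodule.subset_span ⟨i, rfl⟩)
      | zero => simp
      | add a b _ _ ha hb => rw [inner_add_left, ha, hb, add_zero]
      | smul a b _ hb => rw [inner_smul_left, hb, mul_zero]
    rw [← Submodule.orthogonal_closure] at h1
    exact Subtype.ext (inner_self_eq_zero.mp ((Submodule.mem_orthogonal _ _).mp h1 z z.2))
  have hon : Orthonormal ℝ fun i => (⟨u i, hmem i⟩ : K) := hu.codRestrict K hmem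
  obtain ⟨b, hb⟩ : ∃ b : HilbertBasis I ℝ K, ⇑b = fun i => (⟨u i, hmem i⟩ : K) :=
    ⟨_, HilbertBasis.coe_mkOfOrthogonalEqBot hon hbot⟩
  have h := (b.hasSum_repr ⟨x, hx⟩).mapL K.subtypeL
  simpa [hb, HilbertBasis.repr_apply_apply] using h

end Limit

/-! ### Consequences of an arbitrary Schmidt decomposition. -/

section Schmidt

variable {Ω : Type*} [MeasurableSpace Ω] {μ : Measure Ω}
  {H : Type*} [NormedAddCommGroup H] [InnerProductSpace ℝ H] {F : Lp H 2 μ}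

theorem SchmidtDecomposition.coeffOp_apply (S : SchmidtDecomposition F) (i : SchmidtIndex S.r) :
    coeffOp μ H F (S.u i) = S.σ i • S.v i := by
  classical
  have h := S.hasSum.mapL ((coeffOp μ H).flip (S.u i))
  refine h.unique ?_
  convert hasSum_ite_eq i (S.σ i • S.v i) using 2 with j
  rw [ContinuousLinearMap.flip_apply, map_smul, smul_apply, coeffOp_vecMulLp,
    orthonormal_iff_ite.mp S.orthonormal_u]
  by_cases hij : i = j
  · subst hij; simp
  · simp [hij, Ne.symm hij]

theorem SchmidtDecomposition.integral_inner_mul_inner (S : SchmidtDecomposition F)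
    (i j : SchmidtIndex S.r) :
    ∫ y, ⟪S.u i, F y⟫_ℝ * ⟪S.u j, F y⟫_ℝ ∂μ = if i = j then S.σ i ^ 2 else 0 := by
  have h : ⟪coeffOp μ H F (S.u i), coeffOp μ H F (S.u j)⟫_ℝ =
      if i = j then S.σ i ^ 2 else 0 := by
    rw [S.coeffOp_apply, S.coeffOp_apply, inner_smul_left, inner_smul_right,
      orthonormal_iff_ite.mp S.orthonormal_v]
    by_cases hij : i = j
    · subst hij; simp [sq]
    · simp [hij]
  rw [← h, L2.inner_def]
  refine integral_congr_ae ?_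
  filter_upwards [coeffOp_coeFn F (S.u i), coeffOp_coeFn F (S.u j)] with y h1 h2
  rw [h1, h2]
  simp [mul_comm]

/-- L² convergence alone does not give pointwise convergence. Instead, projecting pointwise to the
closed span of the `u i` fixes every term of the series, hence `F`; so almost every value of `F`
lies in that span. -/
theorem SchmidtDecomposition.ae_hasSum [CompleteSpace H] (S : SchmidtDecomposition F) :
    ∀ᵐ y ∂μ, HasSum (fun i => ⟪S.u i, F y⟫_ℝ • S.u i) (F y) := by
  set K := (Submodule.span ℝ (Set.range S.u)).topologicalClosure with hK
  have hKc : CompleteSpace K :=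
    (Submodule.isClosed_topologicalClosure _).completeSpace_coe
  have hmem : ∀ i, S.u i ∈ K := fun i =>
    Submodule.le_topologicalClosure _ (Submodule.subset_span ⟨i, rfl⟩)
  have hP : K.starProjection.compLp F = F := by
    refine (S.hasSum.mapL (K.starProjection.compLpL 2 μ)).unique ?_
    convert S.hasSum using 2 with i
    rw [map_smul]
    congr 1
    refine Lp.ext ?_
    filter_upwards [K.starProjection.coeFn_compLpL (vecMulLp (S.u i) (S.v i)),
      vecMulLp_coeFn (S.u i) (S.v i)] with y h1 h2
    rw [h1, h2, map_smul, Submodule.starProjection_eq_self_iff.mpr (hmem i)]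
  have h := K.starProjection.coeFn_compLp F
  rw [hP] at h
  filter_upwards [h] with y hy
  exact hasSum_inner_smul_of_mem_closure_span S.orthonormal_u
    (Submodule.starProjection_eq_self_iff.mp hy.symm)

end Schmidt

/-! ### Sums over tuples, embeddings and finite sets. -/

section Summation

/-- Every finite set of tuples lies in a cube `s ^ k`, with `s` the set of all their entries; for
nonnegative terms the limit over cubes is therefore the supremum of all finite sums. -/
theorem hasSum_of_tendsto_sum_piFinset {I : Type*} {k : ℕ} {G : (Fin k → I) → ℝ}
    (hG : ∀ j, 0 ≤ G j) {V : ℝ}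
    (hV : Filter.Tendsto (fun s : Finset I => ∑ j ∈ Fintype.piFinset fun _ : Fin k => s, G j)
      Filter.atTop (nhds V)) : HasSum G V := by
  classical
  have hmono : Monotone fun s : Finset I => ∑ j ∈ Fintype.piFinset fun _ : Fin k => s, G j :=
    fun s t hst => Finset.sum_le_sum_of_subset_of_nonneg
      (Fintype.piFinset_subset _ _ fun _ => hst) fun j _ _ => hG j
  refine hasSum_of_isLUB_of_nonneg V hG ⟨?_, fun b hb => ?_⟩
  · rintro _ ⟨t, rfl⟩
    refine le_trans ?_ (hmono.ge_of_tendsto hV (t.biUnion fun j => Finset.univ.image j))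
    refine Finset.sum_le_sum_of_subset_of_nonneg (fun j hj => ?_) fun j _ _ => hG j
    refine Fintype.mem_piFinset.mpr fun a => Finset.mem_biUnion.mpr ⟨j, hj, ?_⟩
    exact Finset.mem_image_of_mem j (Finset.mem_univ a)
  · exact le_of_tendsto' hV fun s => hb ⟨_, rfl⟩

theorem card_embedding_map_univ_eq {I : Type*} {k : ℕ} (s : Finset I) (hs : s.card = k) :
    Nat.card {j : Fin k ↪ I // Finset.univ.map j = s} = k.factorial := by
  classical
  have e : {j : Fin k ↪ I // Finset.univ.map j = s} ≃ (Fin k ↪ s) :=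
    { toFun := fun j => Function.Embedding.codRestrict (s : Set I) j.1 fun a => by
        have := Finset.mem_map_of_mem j.1 (Finset.mem_univ a)
        rwa [j.2] at this
      invFun := fun j => ⟨j.trans (Function.Embedding.subtype _), by
        refine Finset.eq_of_subset_of_card_le (fun x hx => ?_) (by simp [hs])
        obtain ⟨a, -, rfl⟩ := Finset.mem_map.mp hx
        exact (j a).2⟩
      left_inv := fun j => by ext; rfl
      right_inv := fun j => by ext; rfl }
  rw [Nat.card_congr e, Nat.card_eq_fintype_card, Fintype.card_embedding_eq]
  simp [hs, Nat.descFactorial_self]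

theorem hasSum_finset_of_hasSum_embedding {I : Type*} {k : ℕ} {a : I → ℝ} {V : ℝ}
    (h : HasSum (fun j : Fin k ↪ I => ∏ i, a (j i)) V) :
    HasSum (fun s : {s : Finset I // s.card = k} => (k.factorial : ℝ) * ∏ i ∈ s.1, a i) V := by
  classical
  let p : (Fin k ↪ I) → {s : Finset I // s.card = k} := fun j => ⟨Finset.univ.map j, by simp⟩
  have h' := (Equiv.sigmaFiberEquiv p).hasSum_iff.mpr h
  refine h'.sigma fun s => ?_
  have hcard : Nat.card {j // p j = s} = k.factorial := by
    rw [← card_embedding_map_univ_eq s.1 s.2]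
    exact Nat.card_congr (Equiv.subtypeEquivRight fun j => by simp [p, Subtype.ext_iff])
  have hfin : Finite {j // p j = s} := Nat.finite_of_card_ne_zero (by
    rw [hcard]; exact Nat.factorial_ne_zero k)
  have := Fintype.ofFinite {j // p j = s}
  have hval : ∀ j : {j // p j = s},
      ((fun j : Fin k ↪ I => ∏ i, a (j i)) ∘ Equiv.sigmaFiberEquiv p) ⟨s, j⟩ =
        ∏ i ∈ s.1, a i := by
    rintro ⟨j, rfl⟩
    simp [p, Equiv.sigmaFiberEquiv]
  simp only [hval]
  convert hasSum_fintype fun _ : {j // p j = s} => ∏ i ∈ s.1, a i using 1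
  rw [Finset.sum_const, Finset.card_univ, ← Nat.card_eq_fintype_card, hcard, nsmul_eq_mul]

end Summation

/-! ### Passage to the limit and the main theorem. -/

section Main

variable {Ω : Type*} [MeasurableSpace Ω] {μ : Measure Ω} [IsFiniteMeasure μ]
  {H : Type*} [NormedAddCommGroup H] [InnerProductSpace ℝ H] [CompleteSpace H]

theorem SchmidtDecomposition.hasSum_embedding {f : Ω → H} (hf : MemLp f 2 μ)
    (S : SchmidtDecomposition (hf.toLp f)) (k : ℕ) :
    HasSum (fun j : Fin k ↪ SchmidtIndex S.r => ∏ i, S.σ (j i) ^ 2)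
      (∫ y : Fin k → Ω, (Matrix.gram ℝ (fun i => f (y i))).det
        ∂(Measure.pi (fun _ : Fin k => μ))) := by
  classical
  let φ : SchmidtIndex S.r → Ω → ℝ := fun i x => ⟪S.u i, f x⟫_ℝ
  have hφ : ∀ i, MemLp (φ i) 2 μ := fun i => hf.const_inner (S.u i)
  have hφc : ∀ i j, ∫ x, φ i x * φ j x ∂μ = if i = j then S.σ i ^ 2 else 0 := by
    intro i j
    rw [← S.integral_inner_mul_inner]
    refine integral_congr_ae ?_
    filter_upwards [hf.coeFn_toLp] with y hy
    rw [hy]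
  let P : Finset (SchmidtIndex S.r) → Ω → H := fun s x => ∑ i ∈ s, ⟪S.u i, f x⟫_ℝ • S.u i
  have hgram : ∀ s (y : Fin k → Ω), Matrix.gram ℝ (fun a => P s (y a)) =
      Matrix.of fun a b => ∑ i ∈ s, φ i (y a) * φ i (y b) := by
    intro s y
    ext a b
    exact inner_sum_inner_smul S.orthonormal_u s _ _
  have hPm : ∀ s, AEStronglyMeasurable (P s) μ := fun s =>
    Finset.aestronglyMeasurable_fun_sum _ fun i _ => (hφ i).1.smul_const _
  have hlim : Filter.Tendsto (fun s => ∫ y : Fin k → Ω, (Matrix.gram ℝ fun a => P s (y a)).det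
      ∂(Measure.pi fun _ => μ)) Filter.atTop
      (nhds (∫ y : Fin k → Ω, (Matrix.gram ℝ fun a => f (y a)).det
        ∂(Measure.pi fun _ => μ))) := by
    refine tendsto_integral_filter_of_dominated_convergence
      (fun y => k.factorial * ∏ a, ‖f (y a)‖ ^ 2)
      (Filter.Eventually.of_forall fun s => aestronglyMeasurable_det_gram (hPm s) k)
      (Filter.Eventually.of_forall fun s => Filter.Eventually.of_forall fun y => ?_)
      ((integrable_prod_norm_sq hf k).const_mul _) ?_
    -- Projections do not increase norms, so the majorant does not depend on `s`.
    · refine (abs_det_gram_le _).trans ?_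
      gcongr with a
      exact norm_sum_inner_smul_le S.orthonormal_u s _
    · have hae : ∀ᵐ x ∂μ, Filter.Tendsto (fun s => P s x) Filter.atTop (nhds (f x)) := by
        filter_upwards [S.ae_hasSum, hf.coeFn_toLp] with x h1 h2
        rw [h2] at h1
        exact h1
      have hall : ∀ᵐ y : Fin k → Ω ∂(Measure.pi fun _ => μ), ∀ a,
          Filter.Tendsto (fun s => P s (y a)) Filter.atTop (nhds (f (y a))) :=
        ae_all_iff.mpr fun a => (Measure.tendsto_eval_ae_ae (μ := fun _ : Fin k => μ) (i := a)).eventually hae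
      filter_upwards [hall] with y hy
      simp only [Matrix.det_apply', Matrix.gram_apply]
      exact tendsto_finsetSum _ fun τ _ => (tendsto_finsetProd _ fun a _ =>
        (hy (τ a)).inner (hy a)).const_mul _
  simp only [hgram, integral_det_sum_mul φ (fun i => S.σ i ^ 2) hφ hφc k] at hlim
  have hsum := hasSum_of_tendsto_sum_piFinset (fun j => by split_ifs <;> positivity) hlim
  -- Non-injective tuples contribute zero, so the sum restricts to embeddings.
  rw [← (DFunLike.coe_injective (F := Fin k ↪ SchmidtIndex S.r)).hasSum_iff] at hsum
  · convert hsum using 2 with j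
    simp [j.injective]
  · intro j hj
    exact if_neg fun h => hj ⟨⟨j, h⟩, rfl⟩

end Main

theorem mainTheorem3 {Ω : Type*} [MeasurableSpace Ω] (μ : Measure Ω) [IsFiniteMeasure μ]
    (hμ : 0 < μ Set.univ)
    {H : Type*} [NormedAddCommGroup H] [InnerProductSpace ℝ H] [CompleteSpace H]
    (f : Ω → H) (hf : MemLp f 2 μ) (k : ℕ) (hk : 1 ≤ k) :
    Nonempty (SchmidtDecomposition (hf.toLp f)) ∧
    Integrable (fun y : Fin k → Ω => (Matrix.gram ℝ (fun i => f (y i))).det)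
      (Measure.pi (fun _ : Fin k => μ)) ∧
    ∀ S : SchmidtDecomposition (hf.toLp f),
      HasSum (fun j : Fin k ↪ SchmidtIndex S.r => ∏ i, S.σ (j i) ^ 2)
        (∫ y : Fin k → Ω, (Matrix.gram ℝ (fun i => f (y i))).det
          ∂(Measure.pi (fun _ : Fin k => μ))) ∧
      Summable (fun s : {s : Finset (SchmidtIndex S.r) // s.card = k} =>
        ∏ i ∈ s.1, S.σ i ^ 2) ∧
      ∫ y : Fin k → Ω, (Matrix.gram ℝ (fun i => f (y i))).det
          ∂(Measure.pi (fun _ : Fin k => μ)) =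
        (k.factorial : ℝ) *
          ∑' s : {s : Finset (SchmidtIndex S.r) // s.card = k}, ∏ i ∈ s.1, S.σ i ^ 2 := by
  refine ⟨nonempty_schmidtDecomposition _, integrable_det_gram hf k, fun S => ?_⟩
  have h := S.hasSum_embedding hf k
  have h' := hasSum_finset_of_hasSum_embedding (a := fun i => S.σ i ^ 2) h
  have hk0 : (k.factorial : ℝ) ≠ 0 := by exact_mod_cast k.factorial_ne_zero
  refine ⟨h, (summable_mul_left_iff hk0).mp h'.summable, ?_⟩
  rw [← tsum_mul_left, h'.tsum_eq]
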